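/- There are an algorithm on the real RAM (unit-cost exact arithmetic and comparisons on real numbers, without rounding to integers), a constant $K$ and a polynomial $q$ such that the following holds for all integers $d\ge 1$ and $m\ge k\ge 1$, all reals $r>0$ and $\varepsilon\in(0,1]$, and every curve $C=(x_1,\dots,x_m)$ of $m$ points in $\mathbb{R}^d$. Given $(d,m,k,r,\varepsilon,C)$, the algorithm halts after at most $$K\cdot\frac{d\,m\log (m+1)}{\varepsilon}+m\cdot q\!\left(\frac1\varepsilon\right)$$ steps, that is, after $O\!\left(\frac{d\,m\log(m+1)}{\varepsilon}+m\cdot\mathrm{poly}\frac1\varepsilon\right)$ steps, and it either returns a curve $\Pi$ of exactly $k$ points in $\mathbb{R}^d$ with $d_{dF}(C,\Pi)\le(1+\varepsilon)r$, or correctly declares that $d_{dF}(C,\Pi)>r$ for every curve $\Pi$ of $k$ points in $\mathbb{R}^d$. Here the discrete Fréchet distance of $P=(p_1,\dots,p_{m_1})$ and $Q=(q_1,\dots,q_{m_2})$ is $d_{dF}(P,Q)=\min_\tau\max_{(i,j)\in\tau}\|p_i-q_j\|_2$, where $\tau$ ranges over the alignments: the sequences of index pairs that start with $(1,1)$, end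 with $(m_1,m_2)$, and in which each pair $(i,j)$ is followed by $(i+1,j)$, $(i,j+1)$ or $(i+1,j+1)$. -/

import Mathlib

/-! ### Curves and the discrete Frechet distance -/

/-- A curve with `m` vertices in `d`-dimensional Euclidean space. -/
abbrev Curve (d m : ℕ) : Type := Fin m → EuclideanSpace ℝ (Fin d)

/-- The admissible moves of an alignment: advance in the first curve, in the second, or in both. -/
def AlignStep {m n : ℕ} (p q : Fin m × Fin n) : Prop :=
  ((q.1 : ℕ) = p.1 + 1 ∧ (q.2 : ℕ) = p.2) ∨
  ((q.1 : ℕ) = p.1 ∧ (q.2 : ℕ) = p.2 + 1) ∨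
  ((q.1 : ℕ) = p.1 + 1 ∧ (q.2 : ℕ) = p.2 + 1)

/-- An alignment of two curves with `m` and `n` vertices (vertices are numbered from `0`):
it starts at the pair of first vertices, ends at the pair of last vertices, and every two
consecutive pairs are related by an admissible move. -/
structure IsAlignment {m n : ℕ} (τ : List (Fin m × Fin n)) : Prop where
  first : ∃ p, τ.head? = some p ∧ (p.1 : ℕ) = 0 ∧ (p.2 : ℕ) = 0
  last : ∃ p, τ.getLast? = some p ∧ (p.1 : ℕ) + 1 = m ∧ (p.2 : ℕ) + 1 = n
  chain : τ.IsChain AlignStep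

/-- The Frechet cost of `τ`: the largest Euclidean distance of a matched pair. -/
noncomputable def frechetCost {d m n : ℕ} (P : Curve d m) (Q : Curve d n)
    (τ : List (Fin m × Fin n)) : ℝ :=
  (τ.map fun p => dist (P p.1) (Q p.2)).foldr max 0

/-- The discrete Frechet distance: the least Frechet cost of an alignment. For nonempty curves
this infimum is a minimum, see `isLeast_discreteFrechet`. -/
noncomputable def discreteFrechet {d m n : ℕ} (P : Curve d m) (Q : Curve d n) : ℝ :=
  sInf {c | ∃ τ : List (Fin m × Fin n), IsAlignment τ ∧ c = frechetCost P Q τ}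

theorem exists_isAlignment {m n : ℕ} (hm : 1 ≤ m) (hn : 1 ≤ n) :
    ∃ τ : List (Fin m × Fin n), IsAlignment τ := by
  have key : ∀ a b : ℕ, ∀ ha : a < m, ∀ hb : b < n, ∃ τ : List (Fin m × Fin n),
      (∃ p, τ.head? = some p ∧ (p.1 : ℕ) = 0 ∧ (p.2 : ℕ) = 0) ∧
      τ.getLast? = some (⟨a, ha⟩, ⟨b, hb⟩) ∧ τ.IsChain AlignStep := by
    intro a
    induction a with
    | zero =>
      intro b
      induction b with
      | zero => exact fun ha hb => ⟨[(⟨0, ha⟩, ⟨0, hb⟩)], by simp, by simp, by simp⟩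
      | succ b ih =>
        intro ha hb
        obtain ⟨τ, ⟨p, hp, h1, h2⟩, hl, hc⟩ := ih ha (by omega)
        refine ⟨τ ++ [(⟨0, ha⟩, ⟨b + 1, hb⟩)], ⟨p, by simp [hp], h1, h2⟩, by simp, ?_⟩
        refine List.isChain_append.2 ⟨hc, by simp, ?_⟩
        simp [hl, AlignStep]
    | succ a ih =>
      intro b ha hb
      obtain ⟨τ, ⟨p, hp, h1, h2⟩, hl, hc⟩ := ih b (by omega) hb
      refine ⟨τ ++ [(⟨a + 1, ha⟩, ⟨b, hb⟩)], ⟨p, by simp [hp], h1, h2⟩, by simp, ?_⟩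
      refine List.isChain_append.2 ⟨hc, by simp, ?_⟩
      simp [hl, AlignStep]
  obtain ⟨τ, h1, h2, h3⟩ := key (m - 1) (n - 1) (by omega) (by omega)
  exact ⟨τ, h1, ⟨_, h2, by simp; omega, by simp; omega⟩, h3⟩

theorem isLeast_discreteFrechet {d m n : ℕ} (hm : 1 ≤ m) (hn : 1 ≤ n)
    (P : Curve d m) (Q : Curve d n) :
    IsLeast {c | ∃ τ : List (Fin m × Fin n), IsAlignment τ ∧ c = frechetCost P Q τ}
      (discreteFrechet P Q) := by
  have hval : ∀ l : List ℝ, l.foldr max 0 ∈ insert (0 : ℝ) {x | x ∈ l} := by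
    intro l
    induction l with
    | nil => simp
    | cons x l ih =>
      rcases max_choice x (l.foldr max 0) with h | h
      · simp [h]
      · simp only [List.foldr_cons, h]
        rcases ih with ih | ih
        · exact Or.inl ih
        · exact Or.inr (List.mem_cons_of_mem _ ih)
  have hfin : {c | ∃ τ : List (Fin m × Fin n), IsAlignment τ ∧ c = frechetCost P Q τ}.Finite := by
    refine ((Set.finite_range fun p : Fin m × Fin n => dist (P p.1) (Q p.2)).insert 0).subset ?_
    rintro c ⟨τ, -, rfl⟩
    rcases hval (τ.map fun p => dist (P p.1) (Q p.2)) with h | h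
    · exact Or.inl h
    · obtain ⟨p, -, hp⟩ := List.mem_map.1 h
      exact Or.inr ⟨p, hp⟩
  obtain ⟨τ, hτ⟩ := exists_isAlignment hm hn
  exact ⟨Set.Nonempty.csInf_mem ⟨_, τ, hτ, rfl⟩ hfin,
    fun c hc => csInf_le hfin.bddBelow hc⟩

/-! ### The real RAM with unit cost

A machine has natural-number registers, real registers, and arrays of natural numbers and of
reals. Registers and arrays are named by fixed numbers that occur in the program, so that a program
uses finitely many of them; the cells of an array are addressed by the content of a register.
Every elementary instruction and every evaluation of a test costs one step. The natural numbers
have addition, subtraction and halving only; the reals have exact field arithmetic and comparisons,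
with rational constants, and no rounding (no conversion from reals to integers). -/

/-- A configuration of the memory of the machine. -/
structure RamState where
  /-- natural-number registers -/
  nreg : ℕ → ℕ
  /-- real registers -/
  rreg : ℕ → ℝ
  /-- cells of the natural-number arrays: `narr a i` is cell `i` of array `a` -/
  narr : ℕ → ℕ → ℕ
  /-- cells of the real arrays: `rarr a i` is cell `i` of array `a` -/
  rarr : ℕ → ℕ → ℝ

namespace RamState

def setN (s : RamState) (i : ℕ) (v : ℕ) : RamState :=
  { s with nreg := Function.update s.nreg i v }

def setR (s : RamState) (x : ℕ) (v : ℝ) : RamState :=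
  { s with rreg := Function.update s.rreg x v }

def setNArr (s : RamState) (a i : ℕ) (v : ℕ) : RamState :=
  { s with narr := Function.update s.narr a (Function.update (s.narr a) i v) }

def setRArr (s : RamState) (a i : ℕ) (v : ℝ) : RamState :=
  { s with rarr := Function.update s.rarr a (Function.update (s.rarr a) i v) }

end RamState

/-- The elementary instructions; `i j l` name natural-number registers, `x y z` name real
registers, and `a` names an array. The first argument is the target. -/
inductive RamInstr : Type
  | nconst (i c : ℕ)
  | nadd (i j l : ℕ)
  | nsub (i j l : ℕ)
  | nhalf (i j : ℕ)
  | nload (i a j : ℕ)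
  | nstore (a i j : ℕ)
  | rconst (x : ℕ) (c : ℚ)
  | rofNat (x i : ℕ)
  | radd (x y z : ℕ)
  | rsub (x y z : ℕ)
  | rmul (x y z : ℕ)
  | rdiv (x y z : ℕ)
  | rload (x a j : ℕ)
  | rstore (a i x : ℕ)

/-- The effect of an elementary instruction; it is undefined for a division by zero. Subtraction
of natural numbers is truncated and halving rounds down. -/
noncomputable def RamInstr.eval : RamInstr → RamState → Option RamState
  | .nconst i c, s => some (s.setN i c)
  | .nadd i j l, s => some (s.setN i (s.nreg j + s.nreg l))
  | .nsub i j l, s => some (s.setN i (s.nreg j - s.nreg l))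
  | .nhalf i j, s => some (s.setN i (s.nreg j / 2))
  | .nload i a j, s => some (s.setN i (s.narr a (s.nreg j)))
  | .nstore a i j, s => some (s.setNArr a (s.nreg i) (s.nreg j))
  | .rconst x c, s => some (s.setR x (c : ℝ))
  | .rofNat x i, s => some (s.setR x (s.nreg i : ℝ))
  | .radd x y z, s => some (s.setR x (s.rreg y + s.rreg z))
  | .rsub x y z, s => some (s.setR x (s.rreg y - s.rreg z))
  | .rmul x y z, s => some (s.setR x (s.rreg y * s.rreg z))
  | .rdiv x y z, s =>
      open Classical in if s.rreg z = 0 then none else some (s.setR x (s.rreg y / s.rreg z))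
  | .rload x a j, s => some (s.setR x (s.rarr a (s.nreg j)))
  | .rstore a i x, s => some (s.setRArr a (s.nreg i) (s.rreg x))

/-- The tests: comparisons of two registers of the same kind. -/
inductive RamTest : Type
  | nle (i j : ℕ)
  | nlt (i j : ℕ)
  | rle (x y : ℕ)
  | rlt (x y : ℕ)

/-- The test succeeds in the state `s`. -/
def RamTest.Holds : RamTest → RamState → Prop
  | .nle i j, s => s.nreg i ≤ s.nreg j
  | .nlt i j, s => s.nreg i < s.nreg j
  | .rle x y, s => s.rreg x ≤ s.rreg y
  | .rlt x y, s => s.rreg x < s.rreg y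

/-- Programs: elementary instructions, sequencing, branching, and while loops. -/
inductive RamProg : Type
  | instr (c : RamInstr)
  | seq (p q : RamProg)
  | branch (b : RamTest) (p q : RamProg)
  | loop (b : RamTest) (p : RamProg)

/-- `RamExec p s s' t`: started in the memory state `s`, the program `p` halts in the memory
state `s'` after exactly `t` steps. -/
inductive RamExec : RamProg → RamState → RamState → ℕ → Prop
  | instr {c : RamInstr} {s s' : RamState} (h : c.eval s = some s') :
      RamExec (.instr c) s s' 1
  | seq {p q : RamProg} {s s' s'' : RamState} {t u : ℕ}
      (hp : RamExec p s s' t) (hq : RamExec q s' s'' u) :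
      RamExec (.seq p q) s s'' (t + u)
  | branch_true {b : RamTest} {p q : RamProg} {s s' : RamState} {t : ℕ}
      (hb : b.Holds s) (hp : RamExec p s s' t) :
      RamExec (.branch b p q) s s' (t + 1)
  | branch_false {b : RamTest} {p q : RamProg} {s s' : RamState} {t : ℕ}
      (hb : ¬ b.Holds s) (hq : RamExec q s s' t) :
      RamExec (.branch b p q) s s' (t + 1)
  | loop_done {b : RamTest} {p : RamProg} {s : RamState} (hb : ¬ b.Holds s) :
      RamExec (.loop b p) s s 1
  | loop_step {b : RamTest} {p : RamProg} {s s' s'' : RamState} {t u : ℕ}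
      (hb : b.Holds s) (hp : RamExec p s s' t) (hl : RamExec (.loop b p) s' s'' u) :
      RamExec (.loop b p) s s'' (t + u + 1)

/-- The machine is deterministic: the final state and the number of steps are unique. -/
theorem RamExec.deterministic {p : RamProg} {s s₁ s₂ : RamState} {t₁ t₂ : ℕ}
    (h₁ : RamExec p s s₁ t₁) (h₂ : RamExec p s s₂ t₂) : s₁ = s₂ ∧ t₁ = t₂ := by
  induction h₁ generalizing s₂ t₂ with
  | instr h =>
    cases h₂ with
    | instr h' => exact ⟨Option.some.inj (h.symm.trans h'), rfl⟩
  | seq _ _ ihp ihq =>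
    cases h₂ with
    | seq hp hq =>
      obtain ⟨rfl, rfl⟩ := ihp hp
      obtain ⟨rfl, rfl⟩ := ihq hq
      exact ⟨rfl, rfl⟩
  | branch_true hb _ ih =>
    cases h₂ with
    | branch_true _ hp => obtain ⟨rfl, rfl⟩ := ih hp; exact ⟨rfl, rfl⟩
    | branch_false hb' _ => exact absurd hb hb'
  | branch_false hb _ ih =>
    cases h₂ with
    | branch_true hb' _ => exact absurd hb' hb
    | branch_false _ hp => obtain ⟨rfl, rfl⟩ := ih hp; exact ⟨rfl, rfl⟩
  | loop_done hb =>
    cases h₂ with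
    | loop_done _ => exact ⟨rfl, rfl⟩
    | loop_step hb' _ _ => exact absurd hb' hb
  | loop_step hb _ _ ihp ihl =>
    cases h₂ with
    | loop_done hb' => exact absurd hb hb'
    | loop_step _ hp hl =>
      obtain ⟨rfl, rfl⟩ := ihp hp
      obtain ⟨rfl, rfl⟩ := ihl hl
      exact ⟨rfl, rfl⟩

/-! ### Input and output -/

/-- The initial memory for the input `(d, m, k, r, ε, C)`: the natural-number registers `0, 1, 2`
hold `d, m, k`, the real registers `0, 1` hold `r, ε`, cell `i * d + j` of the real array `0` holds
coordinate `j` of vertex `i` of `C`, and everything else is zero. -/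
noncomputable def simplificationInput {d m : ℕ} (k : ℕ) (r ε : ℝ) (C : Curve d m) : RamState where
  nreg i := if i = 0 then d else if i = 1 then m else if i = 2 then k else 0
  rreg x := if x = 0 then r else if x = 1 then ε else 0
  narr _ _ := 0
  rarr a i := if h : a = 0 ∧ i < m * d then
    C (Fin.divNat (⟨i, h.2⟩ : Fin (m * d))) (Fin.modNat (⟨i, h.2⟩ : Fin (m * d))) else 0

/-- The curve with `k` vertices that is written, vertex by vertex, in the real array `1`. -/
noncomputable def outputCurve (d k : ℕ) (s : RamState) : Curve d k :=
  fun i => WithLp.toLp 2 fun j => s.rarr 1 ((i : ℕ) * d + j)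

/-! The program is a greedy scan that cuts the input into consecutive blocks and encloses each block
in a ball of radius `(1 + ε) r`; the ball centers form the output. The current center is kept until
some vertex lies outside its enlarged ball. It then moves towards that vertex by the fraction `2 /
(n + 2)`, where `n` counts the previous moves, and the block is checked again from its start.

If some ball of radius `r` with center `q` contains the block together with the next vertex, then `n
(n + 1) dist c q ^ 2` grows by at most `(12 - 4 ε (n + 1)) r ^ 2` per move (`move_center_bound`).
Since this quantity is nonnegative, such a `q` is impossible once `(n + 1) ε > 6`
(`not_mem_ball_of_many_moves`). The block is then closed with the last center that enclosed it.

Soundness of refusal: a curve within distance `r` yields a monotone assignment of input vertices to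
its vertices, and induction over blocks shows that block `b` starts at a vertex assigned to index at
least `b`. If `k` blocks do not suffice, no such curve exists. Soundness of acceptance: the blocks
form a lattice path of good pairs, and the last center is repeated until there are exactly `k`
vertices.

A potential function bounds the number of rounds by `O(m / ε)`, and each round costs `O(d)` steps.
Hence the total is `O(d m / ε)`, below the required bound. The scan is analysed abstractly
(`Scan.Core.advance`) and then tied to the machine by the relation `Represents`. -/

/-! ### Total correctness with exact step counts -/

/-- `p`, started in `s`, halts in a state and after a number of steps that satisfy `Q`. -/
def RamProg.Runs (p : RamProg) (s : RamState) (Q : RamState → ℕ → Prop) : Prop :=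
  ∃ s' t, RamExec p s s' t ∧ Q s' t

namespace RamProg

theorem Runs.mono {p : RamProg} {s : RamState} {Q Q' : RamState → ℕ → Prop}
    (h : p.Runs s Q) (hQ : ∀ s' t, Q s' t → Q' s' t) : p.Runs s Q' := by
  obtain ⟨s', t, he, hq⟩ := h
  exact ⟨s', t, he, hQ _ _ hq⟩

theorem runs_instr {c : RamInstr} {s : RamState} {Q : RamState → ℕ → Prop} :
    (instr c).Runs s Q ↔ ∃ s', c.eval s = some s' ∧ Q s' 1 := by
  constructor
  · rintro ⟨s', t, he, hq⟩
    cases he with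
    | instr h => exact ⟨s', h, hq⟩
  · rintro ⟨s', h, hq⟩
    exact ⟨s', 1, .instr h, hq⟩

theorem runs_seq {p q : RamProg} {s : RamState} {Q : RamState → ℕ → Prop} :
    (seq p q).Runs s Q ↔ p.Runs s fun s' t => q.Runs s' fun s'' u => Q s'' (t + u) := by
  constructor
  · rintro ⟨s', t, he, hq⟩
    cases he with
    | seq h₁ h₂ => exact ⟨_, _, h₁, _, _, h₂, hq⟩
  · rintro ⟨_, _, h₁, _, _, h₂, hq⟩
    exact ⟨_, _, .seq h₁ h₂, hq⟩

theorem runs_branch_of_holds {b : RamTest} {p q : RamProg} {s : RamState}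
    {Q : RamState → ℕ → Prop} (hb : b.Holds s) (h : p.Runs s fun s' t => Q s' (t + 1)) :
    (branch b p q).Runs s Q := by
  obtain ⟨s', t, he, hq⟩ := h
  exact ⟨s', _, .branch_true hb he, hq⟩

theorem runs_branch_of_not_holds {b : RamTest} {p q : RamProg} {s : RamState}
    {Q : RamState → ℕ → Prop} (hb : ¬ b.Holds s) (h : q.Runs s fun s' t => Q s' (t + 1)) :
    (branch b p q).Runs s Q := by
  obtain ⟨s', t, he, hq⟩ := h
  exact ⟨s', _, .branch_false hb he, hq⟩

/-- A loop halts if an invariant bounds the number of its rounds. -/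
theorem runs_loop {b : RamTest} {p : RamProg} (I : ℕ → RamState → Prop) (B T : ℕ)
    (hB : ∀ n s, I n s → n ≤ B)
    (hstep : ∀ n s, I n s → b.Holds s → p.Runs s fun s' t => t ≤ T ∧ I (n + 1) s')
    {n : ℕ} {s : RamState} (h : I n s) :
    (loop b p).Runs s fun s' t =>
      t ≤ (B - n) * (T + 1) + 1 ∧ ¬ b.Holds s' ∧ ∃ n', I n' s' := by
  induction hk : B - n generalizing n s with
  | zero =>
    by_cases hb : b.Holds s
    · obtain ⟨s', t, -, -, hI⟩ := hstep n s h hb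
      have := hB _ _ hI
      omega
    · exact ⟨s, 1, .loop_done hb, by omega, hb, n, h⟩
  | succ k ih =>
    by_cases hb : b.Holds s
    · obtain ⟨s', t, he, ht, hI⟩ := hstep n s h hb
      obtain ⟨s'', u, he', hu, hr⟩ := ih hI (by omega)
      refine ⟨s'', _, .loop_step hb he he', ?_, hr⟩
      rw [Nat.succ_mul]
      omega
    · exact ⟨s, 1, .loop_done hb, by omega, hb, n, h⟩

/-- Run a list of instructions before the program `q`. -/
def block (l : List RamInstr) (q : RamProg) : RamProg :=
  l.foldr (fun c p => seq (instr c) p) q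

end RamProg

/-! ### The program -/

open RamProg RamInstr RamTest

/-- Run `body` for all values of the natural-number register `11` below the register `0`. The
register `13` holds `1`. -/
def forCoords (body : List RamInstr) : RamProg :=
  seq (instr (nconst 11 0)) (loop (nlt 11 0) (block body (instr (nadd 11 11 13))))

/-- Copy the current center (array `2`) to the output at offset register `10`. -/
def saveCenter : RamProg :=
  forCoords [nadd 12 10 11, rload 5 2 11, rstore 1 12 5]

/-- Put the squared distance of the current center to the input vertex at offset register `4` into
the real register `4`. -/
def sqDistCenter : RamProg :=
  seq (instr (rconst 4 0))
    (forCoords [nadd 12 4 11, rload 5 0 12, rload 6 2 11, rsub 5 5 6, rmul 5 5 5, radd 4 4 5])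

/-- Move the current center towards the input vertex at offset register `4`, by the fraction in
the real register `7`. -/
def moveCenter : RamProg :=
  forCoords [nadd 12 4 11, rload 5 0 12, rload 6 2 11, rsub 5 5 6, rmul 5 7 5, radd 6 6 5,
    rstore 2 11 6]

namespace RamState

/-- The vector of the `d` cells of the real array `a` from cell `o` on. -/
noncomputable def vec (d : ℕ) (s : RamState) (a o : ℕ) : EuclideanSpace ℝ (Fin d) :=
  WithLp.toLp 2 fun j => s.rarr a (o + j)

variable (s : RamState) (d i x : ℕ) (v : ℕ) (w : ℝ)

@[simp] theorem nreg_setN : (s.setN i v).nreg = Function.update s.nreg i v := rfl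
@[simp] theorem rreg_setN : (s.setN i v).rreg = s.rreg := rfl
@[simp] theorem nreg_setR : (s.setR x w).nreg = s.nreg := rfl
@[simp] theorem rreg_setR : (s.setR x w).rreg = Function.update s.rreg x w := rfl
@[simp] theorem vec_setN (a o : ℕ) : (s.setN i v).vec d a o = s.vec d a o := rfl
@[simp] theorem vec_setR (a o : ℕ) : (s.setR x w).vec d a o = s.vec d a o := rfl

end RamState

/-! ### Step counts of the coordinate loops -/

theorem runs_saveCenter {d : ℕ} {s : RamState} (hd : s.nreg 0 = d) (h1 : s.nreg 13 = 1) :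
    saveCenter.Runs s fun s' t => t ≤ 5 * d + 2 ∧
      (∀ x, x ≠ 11 → x ≠ 12 → s'.nreg x = s.nreg x) ∧ (∀ x, x ≠ 5 → s'.rreg x = s.rreg x) ∧
      (∀ a, a ≠ 1 → s'.rarr a = s.rarr a) ∧
      (∀ y, s'.rarr 1 y = if s.nreg 10 ≤ y ∧ y < s.nreg 10 + d then
        s.rarr 2 (y - s.nreg 10) else s.rarr 1 y) := by
  simp only [saveCenter, forCoords, runs_seq, runs_instr, RamInstr.eval, Option.some.injEq,
    exists_eq_left']
  -- Three body instructions and the counter increment make 4 steps per round, 5 with the test; the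
  -- initialisation and the failing last test give the remaining 2.
  refine (runs_loop (fun j s' => s'.nreg 11 = j ∧ j ≤ d ∧
      (∀ x, x ≠ 11 → x ≠ 12 → s'.nreg x = s.nreg x) ∧ (∀ x, x ≠ 5 → s'.rreg x = s.rreg x) ∧
      (∀ a, a ≠ 1 → s'.rarr a = s.rarr a) ∧
      (∀ y, s'.rarr 1 y = if s.nreg 10 ≤ y ∧ y < s.nreg 10 + j then
        s.rarr 2 (y - s.nreg 10) else s.rarr 1 y)) d 4 (fun n _ h => h.2.1) ?_ (n := 0) ?_).mono ?_
  · rintro j s' ⟨hj, hjd, hn, hr, ha, h2⟩ hb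
    simp only [RamTest.Holds, hj, hn 0 (by decide) (by decide), hd] at hb
    simp only [block, List.foldr, runs_seq, runs_instr, RamInstr.eval, Option.some.injEq,
      exists_eq_left', RamState.setN, RamState.setR, RamState.setRArr]
    refine ⟨by norm_num, ?_, hb, ?_, ?_, ?_, ?_⟩
    · simp [hj, hn 13, h1]
    · intro x h11 h12
      simp [h11, h12, hn x]
    · intro x h5
      simp [h5, hr x]
    · intro a ha1
      simp [ha1, ha a]
    · intro y
      simp only [Function.update_self, Function.update_apply, hj, hn 10 (by decide) (by decide),
        ha 2 (by decide), h2 y]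
      norm_num
      split_ifs <;> first | rfl | omega | (congr 1; omega)
  · simp only [RamState.setN]
    refine ⟨by simp, Nat.zero_le _, fun x h11 _ => by simp [h11], by simp, by simp, fun y => ?_⟩
    rw [if_neg (by omega)]
  · rintro s' t ⟨ht, hb, j, hj, hjd, hn, hr, ha, h2⟩
    simp only [RamTest.Holds, hj, hn 0 (by decide) (by decide), hd] at hb
    obtain rfl : j = d := by omega
    exact ⟨by omega, hn, hr, ha, h2⟩

theorem runs_sqDistCenter {d : ℕ} {s : RamState} (hd : s.nreg 0 = d) (h1 : s.nreg 13 = 1) :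
    sqDistCenter.Runs s fun s' t => t ≤ 8 * d + 3 ∧
      (∀ x, x ≠ 11 → x ≠ 12 → s'.nreg x = s.nreg x) ∧
      (∀ x, x ≠ 4 → x ≠ 5 → x ≠ 6 → s'.rreg x = s.rreg x) ∧ s'.rarr = s.rarr ∧
      s'.rreg 4 = dist (s.vec d 0 (s.nreg 4)) (s.vec d 2 0) ^ 2 := by
  have hdist : dist (s.vec d 0 (s.nreg 4)) (s.vec d 2 0) ^ 2 =
      ∑ j ∈ Finset.range d, (s.rarr 0 (s.nreg 4 + j) - s.rarr 2 j) ^ 2 := by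
    rw [EuclideanSpace.dist_eq, Real.sq_sqrt (Finset.sum_nonneg fun _ _ => sq_nonneg _),
      Finset.sum_range]
    simp [RamState.vec, Real.dist_eq, sq_abs]
  simp only [sqDistCenter, forCoords, runs_seq, runs_instr, RamInstr.eval, Option.some.injEq,
    exists_eq_left', hdist]
  refine (runs_loop (fun j s' => s'.nreg 11 = j ∧ j ≤ d ∧
      (∀ x, x ≠ 11 → x ≠ 12 → s'.nreg x = s.nreg x) ∧
      (∀ x, x ≠ 4 → x ≠ 5 → x ≠ 6 → s'.rreg x = s.rreg x) ∧ s'.rarr = s.rarr ∧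
      s'.rreg 4 = ∑ j ∈ Finset.range j, (s.rarr 0 (s.nreg 4 + j) - s.rarr 2 j) ^ 2)
      d 7 (fun n _ h => h.2.1) ?_ (n := 0) ?_).mono ?_
  · rintro j s' ⟨hj, hjd, hn, hr, ha, h2⟩ hb
    simp only [RamTest.Holds, hj, hn 0 (by decide) (by decide), hd] at hb
    simp only [block, List.foldr, runs_seq, runs_instr, RamInstr.eval, Option.some.injEq,
      exists_eq_left', RamState.setN, RamState.setR]
    refine ⟨by norm_num, ?_, hb, ?_, ?_, ha, ?_⟩
    · simp [hj, hn 13, h1]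
    · intro x h11 h12
      simp [h11, h12, hn x]
    · intro x h4 h5 h6
      simp [h4, h5, h6, hr x]
    · rw [Finset.sum_range_succ]
      simp [hj, hn 4, ha, h2, sq]
  · simp only [RamState.setN, RamState.setR]
    exact ⟨by simp, Nat.zero_le _, fun x h11 _ => by simp [h11], fun x h4 _ _ => by simp [h4],
      trivial, by simp⟩
  · rintro s' t ⟨ht, hb, j, hj, hjd, hn, hr, ha, h2⟩
    simp only [RamTest.Holds, hj, hn 0 (by decide) (by decide), hd] at hb
    obtain rfl : j = d := by omega
    exact ⟨by omega, hn, hr, ha, h2⟩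

theorem runs_moveCenter {d : ℕ} {s : RamState} (hd : s.nreg 0 = d) (h1 : s.nreg 13 = 1) :
    moveCenter.Runs s fun s' t => t ≤ 9 * d + 2 ∧
      (∀ x, x ≠ 11 → x ≠ 12 → s'.nreg x = s.nreg x) ∧
      (∀ x, x ≠ 5 → x ≠ 6 → s'.rreg x = s.rreg x) ∧
      (∀ a, a ≠ 2 → s'.rarr a = s.rarr a) ∧
      s'.vec d 2 0 = s.vec d 2 0 +
        s.rreg 7 • (s.vec d 0 (s.nreg 4) - s.vec d 2 0) := by
  simp only [moveCenter, forCoords, runs_seq, runs_instr, RamInstr.eval, Option.some.injEq,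
    exists_eq_left']
  refine (runs_loop (fun j s' => s'.nreg 11 = j ∧ j ≤ d ∧
      (∀ x, x ≠ 11 → x ≠ 12 → s'.nreg x = s.nreg x) ∧
      (∀ x, x ≠ 5 → x ≠ 6 → s'.rreg x = s.rreg x) ∧
      (∀ a, a ≠ 2 → s'.rarr a = s.rarr a) ∧
      (∀ y, s'.rarr 2 y = if y < j then
        s.rarr 2 y + s.rreg 7 * (s.rarr 0 (s.nreg 4 + y) - s.rarr 2 y) else s.rarr 2 y))
      d 8 (fun n _ h => h.2.1) ?_ (n := 0) ?_).mono ?_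
  · rintro j s' ⟨hj, hjd, hn, hr, ha, h2⟩ hb
    simp only [RamTest.Holds, hj, hn 0 (by decide) (by decide), hd] at hb
    simp only [block, List.foldr, runs_seq, runs_instr, RamInstr.eval, Option.some.injEq,
      exists_eq_left', RamState.setN, RamState.setR, RamState.setRArr]
    refine ⟨by norm_num, ?_, hb, ?_, ?_, ?_, ?_⟩
    · simp [hj, hn 13, h1]
    · intro x h11 h12
      simp [h11, h12, hn x]
    · intro x h5 h6
      simp [h5, h6, hr x]
    · intro a ha2
      simp [ha2, ha a]
    · intro y
      rcases lt_trichotomy y j with hy | rfl | hy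
      · simp [hj, hy.ne, h2, hy, hy.trans (Nat.lt_succ_self j)]
      · simp [hj, hn 4, ha 0, hr 7, h2]
      · simp [hj, hy.ne', h2, hy.not_gt, hy.not_ge]
  · simp only [RamState.setN]
    exact ⟨by simp, Nat.zero_le _, fun x h11 _ => by simp [h11], by simp, by simp, by simp⟩
  · rintro s' t ⟨ht, hb, j, hj, hjd, hn, hr, ha, h2⟩
    simp only [RamTest.Holds, hj, hn 0 (by decide) (by decide), hd] at hb
    obtain rfl : j = d := by omega
    refine ⟨by omega, hn, hr, ha, ?_⟩
    ext x
    simp [RamState.vec, h2]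

/-! ### Alignments as lattice paths -/

/-- `(i, j)` is the end of a lattice path from `(0, 0)` with the moves of an alignment, all of
whose pairs satisfy `good`. -/
inductive LatticePath (good : ℕ → ℕ → Prop) : ℕ → ℕ → Prop
  | start (h : good 0 0) : LatticePath good 0 0
  | right {i j : ℕ} (hp : LatticePath good i j) (h : good (i + 1) j) : LatticePath good (i + 1) j
  | up {i j : ℕ} (hp : LatticePath good i j) (h : good i (j + 1)) : LatticePath good i (j + 1)
  | diag {i j : ℕ} (hp : LatticePath good i j) (h : good (i + 1) (j + 1)) :
      LatticePath good (i + 1) (j + 1)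

theorem LatticePath.mono {good good' : ℕ → ℕ → Prop} {i j : ℕ} (hp : LatticePath good i j)
    (h : ∀ i' j', j' ≤ j → good i' j' → good' i' j') : LatticePath good' i j := by
  induction hp with
  | start h0 => exact .start (h _ _ le_rfl h0)
  | right _ hg ih => exact .right (ih h) (h _ _ le_rfl hg)
  | up _ hg ih => exact .up (ih fun i' j' hj => h i' j' (by omega)) (h _ _ le_rfl hg)
  | diag _ hg ih => exact .diag (ih fun i' j' hj => h i' j' (by omega)) (h _ _ le_rfl hg)

theorem foldr_max_le_iff {R : ℝ} (hR : 0 ≤ R) (l : List ℝ) :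
    l.foldr max 0 ≤ R ↔ ∀ x ∈ l, x ≤ R := by
  induction l with
  | nil => simpa using hR
  | cons x l ih => simp [ih]

theorem frechetCost_le_iff {d m n : ℕ} {P : Curve d m} {Q : Curve d n} {R : ℝ} (hR : 0 ≤ R)
    (τ : List (Fin m × Fin n)) :
    frechetCost P Q τ ≤ R ↔ ∀ p ∈ τ, dist (P p.1) (Q p.2) ≤ R := by
  rw [frechetCost, foldr_max_le_iff hR, List.forall_mem_map]

/-- Recording the pairs along the path gives an alignment whose cost is at most `R`. Indices start
at `0`, so the path must end at `(m, n)` for curves with `m + 1` and `n + 1` vertices. -/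
theorem discreteFrechet_le_of_latticePath {d m n : ℕ} {P : Curve d (m + 1)} {Q : Curve d (n + 1)}
    {R : ℝ} (hR : 0 ≤ R) {good : ℕ → ℕ → Prop}
    (hg : ∀ i j (hi : i < m + 1) (hj : j < n + 1), good i j → dist (P ⟨i, hi⟩) (Q ⟨j, hj⟩) ≤ R)
    (hp : LatticePath good m n) : discreteFrechet P Q ≤ R := by
  have key : ∀ i j, LatticePath good i j → ∀ (hi : i < m + 1) (hj : j < n + 1),
      ∃ τ : List (Fin (m + 1) × Fin (n + 1)),
        (∃ p, τ.head? = some p ∧ (p.1 : ℕ) = 0 ∧ (p.2 : ℕ) = 0) ∧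
        τ.getLast? = some (⟨i, hi⟩, ⟨j, hj⟩) ∧ τ.IsChain AlignStep ∧
        ∀ p ∈ τ, dist (P p.1) (Q p.2) ≤ R := by
    intro i j hij
    have snoc : ∀ {i j i' j' : ℕ} (hi : i < m + 1) (hj : j < n + 1) (hi' : i' < m + 1)
        (hj' : j' < n + 1), AlignStep (⟨i, hi⟩, ⟨j, hj⟩) (⟨i', hi'⟩, ⟨j', hj'⟩) → good i' j' →
        (∃ τ : List (Fin (m + 1) × Fin (n + 1)),
          (∃ p, τ.head? = some p ∧ (p.1 : ℕ) = 0 ∧ (p.2 : ℕ) = 0) ∧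
          τ.getLast? = some (⟨i, hi⟩, ⟨j, hj⟩) ∧ τ.IsChain AlignStep ∧
          ∀ p ∈ τ, dist (P p.1) (Q p.2) ≤ R) →
        ∃ τ : List (Fin (m + 1) × Fin (n + 1)),
          (∃ p, τ.head? = some p ∧ (p.1 : ℕ) = 0 ∧ (p.2 : ℕ) = 0) ∧
          τ.getLast? = some (⟨i', hi'⟩, ⟨j', hj'⟩) ∧ τ.IsChain AlignStep ∧
          ∀ p ∈ τ, dist (P p.1) (Q p.2) ≤ R := by
      rintro i j i' j' hi hj hi' hj' hs hgood ⟨τ, ⟨p, hp0, h1, h2⟩, hl, hc, hd⟩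
      refine ⟨τ ++ [(⟨i', hi'⟩, ⟨j', hj'⟩)], ⟨p, by simp [hp0], h1, h2⟩, by simp, ?_, ?_⟩
      · refine List.isChain_append.2 ⟨hc, by simp, ?_⟩
        simpa [hl] using hs
      · intro p hp
        rcases List.mem_append.1 hp with hp | hp
        · exact hd p hp
        · rw [List.mem_singleton.1 hp]
          exact hg _ _ _ _ hgood
    induction hij with
    | start h =>
      intro hi hj
      exact ⟨[(⟨0, hi⟩, ⟨0, hj⟩)], by simp, by simp, by simp, by simpa using hg 0 0 hi hj h⟩
    | right _ h ih =>
      intro hi hj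
      exact snoc (by omega) hj hi hj (by simp [AlignStep]) h (ih _ _)
    | up _ h ih =>
      intro hi hj
      exact snoc hi (by omega) hi hj (by simp [AlignStep]) h (ih _ _)
    | diag _ h ih =>
      intro hi hj
      exact snoc (by omega) (by omega) hi hj (by simp [AlignStep]) h (ih _ _)
  obtain ⟨τ, h1, h2, h3, h4⟩ := key m n hp (by omega) (by omega)
  have hle := (isLeast_discreteFrechet (by omega) (by omega) P Q).2
    ⟨τ, ⟨h1, ⟨_, h2, rfl, rfl⟩, h3⟩, rfl⟩
  exact hle.trans ((frechetCost_le_iff hR τ).2 h4)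

/-! ### From alignments to monotone assignments -/

theorem exists_mem_fst_eq_of_isChain {m n : ℕ} {τ : List (Fin m × Fin n)}
    (hc : τ.IsChain AlignStep) {p q : Fin m × Fin n} (hp : τ.head? = some p)
    (hq : τ.getLast? = some q) {i : Fin m} (h1 : p.1 ≤ i) (h2 : i ≤ q.1) :
    ∃ j, (i, j) ∈ τ := by
  induction τ generalizing p with
  | nil => simp at hp
  | cons x l ih =>
    obtain rfl : x = p := by simpa using hp
    rcases eq_or_lt_of_le h1 with h | h
    · exact ⟨x.2, by simp [← h]⟩
    · cases l with
      | nil =>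
        obtain rfl : x = q := by simpa using hq
        exact absurd h2 h.not_ge
      | cons y l =>
        rw [List.isChain_cons_cons] at hc
        have hy : y.1 ≤ i := by
          have := hc.1
          simp only [AlignStep] at this
          rw [Fin.le_def]
          rw [Fin.lt_def] at h
          omega
        obtain ⟨j, hj⟩ := ih hc.2 rfl (by simpa using hq) hy
        exact ⟨j, List.mem_cons_of_mem _ hj⟩

/-- Each index occurs as a first coordinate because moves advance it by at most one. Any choice of
partners is monotone, since any two pairs of an alignment are comparable in the product order. -/
theorem IsAlignment.exists_monotone {m n : ℕ} {τ : List (Fin m × Fin n)} (hτ : IsAlignment τ) :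
    ∃ φ : Fin m → Fin n, Monotone φ ∧ ∀ i, (i, φ i) ∈ τ := by
  have hex : ∀ i : Fin m, ∃ j, (i, j) ∈ τ := by
    intro i
    obtain ⟨p, hp, hp1, -⟩ := hτ.first
    obtain ⟨q, hq, hq1, -⟩ := hτ.last
    exact exists_mem_fst_eq_of_isChain hτ.chain hp hq
      (Fin.le_def.2 (by omega)) (Fin.le_def.2 (by omega))
  choose φ hφ using hex
  have hchain : τ.IsChain fun p q => p.1 ≤ q.1 ∧ p.2 ≤ q.2 := by
    refine hτ.chain.imp fun p q hpq => ?_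
    rw [AlignStep] at hpq
    exact ⟨Fin.le_def.2 (by omega), Fin.le_def.2 (by omega)⟩
  have : IsTrans (Fin m × Fin n) fun p q => p.1 ≤ q.1 ∧ p.2 ≤ q.2 :=
    ⟨fun p q s h₁ h₂ => ⟨h₁.1.trans h₂.1, h₁.2.trans h₂.2⟩⟩
  -- The relation is symmetrised so that it applies to two members of `τ` whose order in the list is
  -- unknown.
  have hpw : τ.Pairwise fun p q => (p.1 ≤ q.1 ∧ p.2 ≤ q.2) ∨ (q.1 ≤ p.1 ∧ q.2 ≤ p.2) :=
    hchain.pairwise.imp Or.inl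
  have : Std.Symm fun p q : Fin m × Fin n =>
      (p.1 ≤ q.1 ∧ p.2 ≤ q.2) ∨ (q.1 ≤ p.1 ∧ q.2 ≤ p.2) := ⟨fun _ _ h => h.symm⟩
  refine ⟨φ, fun i j hij => ?_, hφ⟩
  rcases eq_or_lt_of_le hij with rfl | hlt
  · exact le_rfl
  · have hor : (i ≤ j ∧ φ i ≤ φ j) ∨ (j ≤ i ∧ φ j ≤ φ i) :=
      List.Pairwise.forall_of_forall (R := fun p q : Fin m × Fin n =>
        (p.1 ≤ q.1 ∧ p.2 ≤ q.2) ∨ (q.1 ≤ p.1 ∧ q.2 ≤ p.2))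
        (fun _ _ => Or.inl ⟨le_rfl, le_rfl⟩) hpw (hφ i) (hφ j)
    rcases hor with h | h
    · exact h.2
    · exact absurd h.1 hlt.not_ge

theorem exists_frechetCost_eq_discreteFrechet {d m n : ℕ} (hm : 1 ≤ m) (hn : 1 ≤ n)
    (P : Curve d m) (Q : Curve d n) :
    ∃ τ : List (Fin m × Fin n), IsAlignment τ ∧ discreteFrechet P Q = frechetCost P Q τ :=
  (isLeast_discreteFrechet hm hn P Q).1

/-- A curve within Frechet distance `r` gives a monotone assignment of vertices to vertices. -/
theorem exists_monotone_of_discreteFrechet_le {d m n : ℕ} (hm : 1 ≤ m) (hn : 1 ≤ n)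
    {P : Curve d m} {Q : Curve d n} {r : ℝ} (hr : 0 ≤ r) (h : discreteFrechet P Q ≤ r) :
    ∃ φ : Fin m → Fin n, Monotone φ ∧ ∀ i, dist (P i) (Q (φ i)) ≤ r := by
  obtain ⟨τ, hτ, hcost⟩ := exists_frechetCost_eq_discreteFrechet hm hn P Q
  have hle : ∀ p ∈ τ, dist (P p.1) (Q p.2) ≤ r := by
    rw [← frechetCost_le_iff hr, ← hcost]
    exact h
  obtain ⟨φ, hφ, hmem⟩ := hτ.exists_monotone
  exact ⟨φ, hφ, fun i => hle (i, φ i) (hmem i)⟩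

/-- There is a lattice path of good pairs that covers the first `a` vertices of the first curve
and the first `b` vertices of the second one. -/
def LatticeCovers (good : ℕ → ℕ → Prop) (a b : ℕ) : Prop :=
  (a = 0 ∧ b = 0) ∨ ∃ a' b', a = a' + 1 ∧ b = b' + 1 ∧ LatticePath good a' b'

namespace LatticeCovers

theorem mono {good good' : ℕ → ℕ → Prop} {a b : ℕ} (h : LatticeCovers good a b)
    (hg : ∀ i j, j < b → good i j → good' i j) : LatticeCovers good' a b := by
  rcases h with h | ⟨a', b', rfl, rfl, hp⟩
  · exact Or.inl h
  · exact Or.inr ⟨a', b', rfl, rfl, hp.mono fun i j hj => hg i j (by omega)⟩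

/-- A diagonal move (or the start of the path) reaches `(a, b)`, and right moves cover the rest of
the block. This needs the block to be nonempty. -/
theorem add_block {good : ℕ → ℕ → Prop} {a b : ℕ} (h : LatticeCovers good a b) {a' : ℕ}
    (haa : a < a') (hg : ∀ j, a ≤ j → j < a' → good j b) : LatticeCovers good a' (b + 1) := by
  induction a', Nat.succ_le_of_lt haa using Nat.le_induction with
  | base =>
    have hab := hg a le_rfl haa
    rcases h with ⟨rfl, rfl⟩ | ⟨a₀, b₀, rfl, rfl, hp⟩
    · exact Or.inr ⟨0, 0, rfl, rfl, .start hab⟩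
    · exact Or.inr ⟨a₀ + 1, b₀ + 1, rfl, rfl, .diag hp hab⟩
  | succ a' hle ih =>
    rcases ih (by omega) fun j h1 h2 => hg j h1 (by omega) with h' | ⟨a₀, b₀, rfl, hb, hp⟩
    · omega
    · obtain rfl : b = b₀ := by omega
      exact Or.inr ⟨_, _, rfl, rfl, .right hp (hg _ (by omega) (by omega))⟩

/-- An up move matches the last covered vertex once more; this pads the output to exactly `k`
vertices. -/
theorem add_repeat {good : ℕ → ℕ → Prop} {a b : ℕ} (h : LatticeCovers good (a + 1) b)
    (hg : good a b) : LatticeCovers good (a + 1) (b + 1) := by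
  rcases h with h | ⟨a₀, b₀, ha, rfl, hp⟩
  · omega
  · obtain rfl : a = a₀ := by omega
    exact Or.inr ⟨_, _, rfl, rfl, .up hp hg⟩

end LatticeCovers

/-! ### Moving a center towards violated points -/

section Center

variable {E : Type*} [NormedAddCommGroup E]

/-- The negative last term is the gain from moving the center towards a distant vertex. -/
theorem norm_sq_convex_combination [InnerProductSpace ℝ E] (γ : ℝ) (x y : E) :
    ‖(1 - γ) • x + γ • y‖ ^ 2 =
      (1 - γ) * ‖x‖ ^ 2 + γ * ‖y‖ ^ 2 - γ * (1 - γ) * ‖x - y‖ ^ 2 := by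
  rw [norm_add_sq_real, norm_sub_sq_real, norm_smul, norm_smul, mul_pow, mul_pow,
    Real.norm_eq_abs, Real.norm_eq_abs, sq_abs, sq_abs, real_inner_smul_left,
    real_inner_smul_right]
  ring

/-- Let `q` be the center of a ball of radius `r` that contains `p`, and let `p` violate the ball
of radius `(1 + ε) r` around `c`. A move of `c` towards `p` brings it closer to `q`. -/
theorem move_center_bound [InnerProductSpace ℝ E] {p q c : E} {r ε : ℝ} {n : ℕ} (hr : 0 < r) (hε : 0 < ε) (hε1 : ε ≤ 1)
    (hq : dist p q ≤ r) (hc : (1 + ε) * r < dist p c)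
    (h : (n * (n + 1) : ℝ) * dist c q ^ 2 ≤ (12 * n - 2 * ε * n * (n + 1)) * r ^ 2) :
    (((n + 1 : ℕ) : ℝ) * ((n + 1 : ℕ) + 1)) * dist (c + (2 / (n + 2 : ℝ)) • (p - c)) q ^ 2 ≤
      (12 * (n + 1 : ℕ) - 2 * ε * (n + 1 : ℕ) * ((n + 1 : ℕ) + 1)) * r ^ 2 := by
  have hn : (0 : ℝ) ≤ n := Nat.cast_nonneg n
  set γ : ℝ := 2 / (n + 2 : ℝ) with hγ
  have hγn : γ * (n + 2) = 2 := by rw [hγ]; field_simp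
  have hmove : dist (c + γ • (p - c)) q ^ 2 =
      (1 - γ) * dist c q ^ 2 + γ * dist p q ^ 2 - γ * (1 - γ) * dist p c ^ 2 := by
    have h1 : c + γ • (p - c) - q = (1 - γ) • (c - q) + γ • (p - q) := by module
    have h2 : (c - q) - (p - q) = c - p := by abel
    rw [dist_eq_norm, h1, norm_sq_convex_combination, h2, dist_eq_norm c q, dist_eq_norm p q,
      dist_comm p c, dist_eq_norm c p]
  have hp2 : dist p q ^ 2 ≤ r ^ 2 := pow_le_pow_left₀ dist_nonneg hq 2
  -- Here `(1 + ε) ^ 2 ≥ 1 + 2 ε`.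
  have hc2 : (1 + 2 * ε) * r ^ 2 ≤ dist p c ^ 2 := by
    have := pow_le_pow_left₀ (by positivity) hc.le 2
    nlinarith [sq_nonneg (ε * r)]
  rw [hmove]
  push_cast
  -- The weight `(n + 1)(n + 2)` makes the recursion telescope: by the choice of `γ`, the
  -- coefficient of the old squared distance becomes `n (n + 1)`.
  have e1 : (n + 1 : ℝ) * (n + 1 + 1) * ((1 - γ) * dist c q ^ 2 + γ * dist p q ^ 2
      - γ * (1 - γ) * dist p c ^ 2) = n * (n + 1) * dist c q ^ 2
      + 2 * (n + 1) * dist p q ^ 2 - (n + 1) * (2 * (1 - γ)) * dist p c ^ 2 := by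
    linear_combination (n + 1 : ℝ) *
      (- dist c q ^ 2 + dist p q ^ 2 - (1 - γ) * dist p c ^ 2) * hγn
  rw [e1]
  have hγ1 : 0 ≤ 1 - γ := by
    have : γ * (n + 2) - 2 + (n : ℝ) = n := by rw [hγn]; ring
    have : (1 - γ) * (n + 2) = n := by linarith
    by_contra hneg
    push Not at hneg
    nlinarith
  have f1 : 2 * (n + 1) * dist p q ^ 2 ≤ 2 * (n + 1) * r ^ 2 := by gcongr
  have f2 : (n + 1) * (2 * (1 - γ)) * ((1 + 2 * ε) * r ^ 2)
      ≤ (n + 1) * (2 * (1 - γ)) * dist p c ^ 2 := by gcongr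
  have hγ0 : 0 ≤ γ := by positivity
  -- With `1 + 2 ε ≤ 3`, the increase is at most `(2 · 6 - 4 ε (n + 1)) r ^ 2`. The 12 comes from
  -- here, and `4 ε (n + 1)` is the increment of `2 ε n (n + 1)`.
  have f3 : (n + 1) * γ ≤ 2 := by nlinarith
  have f4 : (n + 1) * γ * (1 + 2 * ε) ≤ 2 * 3 :=
    mul_le_mul f3 (by linarith) (by positivity) (by norm_num)
  have f5 := mul_le_mul_of_nonneg_right f4 (sq_nonneg r)
  nlinarith

/-- The right side of `h` is `-2 n ((n + 1) ε - 6) r ^ 2`, which is negative; `ε ≤ 1` excludes `n =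
0`. -/
theorem not_mem_ball_of_many_moves {q c : E} {r ε : ℝ} {n : ℕ} (hr : 0 < r) (hε1 : ε ≤ 1)
    (hn : 6 < (n + 1 : ℝ) * ε)
    (h : (n * (n + 1) : ℝ) * dist c q ^ 2 ≤ (12 * n - 2 * ε * n * (n + 1)) * r ^ 2) : False := by
  have hn0 : (0 : ℝ) < n := by
    rcases Nat.eq_zero_or_pos n with rfl | h0
    · norm_num at hn
      linarith
    · exact_mod_cast h0
  have h1 : 0 ≤ (n * (n + 1) : ℝ) * dist c q ^ 2 := by positivity
  have h2 : 0 < (n : ℝ) * ((n + 1) * ε - 6) * r ^ 2 := by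
    have : 0 < (n + 1 : ℝ) * ε - 6 := by linarith
    positivity
  nlinarith

end Center

/-! ### The scan -/

/-- The state of the scan: the next vertex `i` to check, the end `M` of the part of the current
block that has been enclosed, the start `a` of the block, its number `b`, the number `n` of moves
of its center, the center, and the output curve. -/
structure Scan (E : Type*) where
  i : ℕ
  M : ℕ
  a : ℕ
  b : ℕ
  n : ℕ
  c : E
  out : ℕ → E

namespace Scan

variable {E : Type*} [NormedAddCommGroup E]

/-- If the center encloses the current block, then write it to the output. -/
def save (σ : Scan E) : Scan E :=
  if σ.M ≤ σ.i then { σ with out := Function.update σ.out σ.b σ.c } else σ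

open Classical in
/-- Check the next vertex. -/
noncomputable def advance [InnerProductSpace ℝ E] (m : ℕ) (r ε : ℝ) (p : ℕ → E) (σ : Scan E) : Scan E :=
  if σ.i < m then
    if dist (p σ.i) σ.c ≤ (1 + ε) * r then { σ with i := σ.i + 1, M := max σ.M (σ.i + 1) }
    else if (σ.n + 1 : ℝ) * ε ≤ 6 then
      { σ with i := σ.a, n := σ.n + 1, c := σ.c + (2 / (σ.n + 2 : ℝ)) • (p σ.i - σ.c) }
    else { σ with i := σ.M, a := σ.M, b := σ.b + 1, n := 0 }
  else { σ with b := σ.b + 1 }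

/-- The part of the invariant of the scan, after `t` rounds, that `save` does not affect. -/
structure Core (m k : ℕ) (r ε : ℝ) (p : ℕ → E) (t : ℕ) (σ : Scan E) : Prop where
  a_le_i : σ.a ≤ σ.i
  i_le_M : σ.i ≤ σ.M
  M_le_m : σ.M ≤ m
  a_lt_m : σ.a < m
  b_le_k : σ.b ≤ k
  -- Once the last vertex is enclosed, the scan never restarts a block.
  i_eq_m : σ.M = m → σ.i = m
  n_le : (σ.n : ℝ) * ε ≤ 6
  -- The right side is a potential that every round raises by at least one.
  rounds : (t : ℝ) ≤ 2 * (6 / ε + 1) * σ.a + σ.n * (σ.M - σ.a + 1) + (σ.i - σ.a) + σ.b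
  center : ∀ j, σ.a ≤ j → j < σ.i → dist (p j) σ.c ≤ (1 + ε) * r
  -- The range includes `M` itself, the first vertex not yet enclosed, because it may be the one
  -- that causes a move.
  moves : ∀ q, (∀ j, σ.a ≤ j → j ≤ σ.M → j < m → dist (p j) q ≤ r) →
    (σ.n * (σ.n + 1) : ℝ) * dist σ.c q ^ 2 ≤ (12 * σ.n - 2 * ε * σ.n * (σ.n + 1)) * r ^ 2
  lower : σ.i < m → ∀ (φ : ℕ → ℕ) (Q : ℕ → E), (∀ i j, i ≤ j → j < m → φ i ≤ φ j) →
    (∀ j, j < m → dist (p j) (Q (φ j)) ≤ r) → σ.b ≤ φ σ.a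
  -- Either block `b` is still open, or all vertices are covered and only padding remains.
  upper : (LatticeCovers (fun i j => dist (p i) (σ.out j) ≤ (1 + ε) * r) σ.a σ.b ∧
      (σ.i = m → σ.b < k)) ∨
    (σ.i = m ∧ LatticeCovers (fun i j => dist (p i) (σ.out j) ≤ (1 + ε) * r) m σ.b)

/-- The invariant of the scan after `t` rounds. -/
structure Inv (m k : ℕ) (r ε : ℝ) (p : ℕ → E) (t : ℕ) (σ : Scan E) : Prop
    extends Core m k r ε p t σ where
  -- While a moved center is being rechecked, the output still holds an earlier center that encloses
  -- all of `[a, M)`.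
  saved : σ.i < σ.M → ∀ j, σ.a ≤ j → j < σ.M → dist (p j) (σ.out σ.b) ≤ (1 + ε) * r

variable {m k : ℕ} {r ε : ℝ} {p : ℕ → E} {t : ℕ} {σ : Scan E}

/-- Overwriting output cell `b` is harmless: the covering path uses only cells below `b`. After the
save, cell `b` encloses `[a, M)` unconditionally. -/
theorem Inv.save (h : Inv m k r ε p t σ) : Core m k r ε p t σ.save ∧
    ∀ j, σ.save.a ≤ j → j < σ.save.M → dist (p j) (σ.save.out σ.save.b) ≤ (1 + ε) * r := by
  by_cases hM : σ.M ≤ σ.i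
  · have hmono : ∀ {a : ℕ}, LatticeCovers (fun i j => dist (p i) (σ.out j) ≤ (1 + ε) * r) a σ.b →
        LatticeCovers (fun i j => dist (p i) (Function.update σ.out σ.b σ.c j) ≤ (1 + ε) * r)
          a σ.b := fun hc => hc.mono fun i j hj hd => by
      simpa only [Function.update_of_ne hj.ne] using hd
    simp only [Scan.save, if_pos hM]
    refine ⟨⟨h.a_le_i, h.i_le_M, h.M_le_m, h.a_lt_m, h.b_le_k, h.i_eq_m, h.n_le, h.rounds,
      h.center, h.moves, h.lower, ?_⟩, fun j h1 h2 => ?_⟩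
    · exact h.upper.imp (fun hu => ⟨hmono hu.1, hu.2⟩) fun hu => ⟨hu.1, hmono hu.2⟩
    · rw [Function.update_self]
      exact h.center j h1 (h2.trans_le hM)
  · simp only [Scan.save, if_neg hM]
    exact ⟨h.toCore, h.saved (by omega)⟩

/-- The four cases are acceptance, a move of the center, closing a block, and padding after the last
vertex. Only closing changes the lower bound. -/
theorem Core.advance [InnerProductSpace ℝ E] (hr : 0 < r) (hε : 0 < ε) (hε1 : ε ≤ 1) (h : Core m k r ε p t σ)
    (hs : ∀ j, σ.a ≤ j → j < σ.M → dist (p j) (σ.out σ.b) ≤ (1 + ε) * r) (hb : σ.b < k) :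
    Inv m k r ε p (t + 1) (σ.advance m r ε p) := by
  have hai : (σ.a : ℝ) ≤ σ.i := Nat.cast_le.2 h.a_le_i
  have hiM : (σ.i : ℝ) ≤ σ.M := Nat.cast_le.2 h.i_le_M
  have hn0 : (0 : ℝ) ≤ σ.n := Nat.cast_nonneg _
  have hrounds := h.rounds
  have hle_i := h.a_le_i
  have hle_M := h.i_le_M
  have hle_m := h.M_le_m
  by_cases him : σ.i < m
  · have hcov : LatticeCovers (fun i j => dist (p i) (σ.out j) ≤ (1 + ε) * r) σ.a σ.b :=
      h.upper.elim (fun hu => hu.1) fun hu => absurd hu.1 him.ne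
    have hMm : σ.M < m := lt_of_le_of_ne hle_m fun he => him.ne (h.i_eq_m he)
    by_cases hd : dist (p σ.i) σ.c ≤ (1 + ε) * r
    · simp only [Scan.advance, if_pos him, if_pos hd]
      refine ⟨⟨by simp only; omega, by simp only; omega, by simp only; omega, h.a_lt_m, h.b_le_k,
        fun he => by simp only at he ⊢; omega, h.n_le, ?_, fun j h1 h2 => ?_, fun q hq => ?_,
        fun _ => h.lower him, Or.inl ⟨hcov, fun _ => hb⟩⟩, fun h1 j h2 h3 => ?_⟩
      · have hmax : (σ.M : ℝ) ≤ (max σ.M (σ.i + 1) : ℕ) := Nat.cast_le.2 (le_max_left _ _)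
        have := mul_le_mul_of_nonneg_left hmax hn0
        push_cast at this ⊢
        nlinarith
      · rcases Nat.lt_succ_iff_lt_or_eq.1 h2 with h2 | rfl
        · exact h.center j h1 h2
        · exact hd
      · exact h.moves q fun j h1 h2 => hq j h1 (h2.trans (le_max_left _ _))
      · simp only at h1 h2 h3
        exact hs j h2 (by omega)
    · have hd' : (1 + ε) * r < dist (p σ.i) σ.c := not_le.1 hd
      by_cases hn : (σ.n + 1 : ℝ) * ε ≤ 6
      · simp only [Scan.advance, if_pos him, if_neg hd, if_pos hn]
        refine ⟨⟨le_rfl, by simp only; omega, hle_m, h.a_lt_m, h.b_le_k,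
          fun he => absurd he hMm.ne, by push_cast; exact hn, ?_,
          fun j h1 h2 => absurd h1 h2.not_ge,
          fun q hq => ?_, fun _ => h.lower him, Or.inl ⟨hcov, fun _ => hb⟩⟩,
          fun _ => hs⟩
        -- The new move adds `M - a + 1` to the potential, and the restart loses at most `M - a`.
        · push_cast
          nlinarith
        · exact move_center_bound hr hε hε1 (hq _ hle_i hle_M him) hd' (h.moves q hq)
      · have hno : ∀ q, ¬ ∀ j, σ.a ≤ j → j ≤ σ.M → j < m → dist (p j) q ≤ r := fun q hq =>
          not_mem_ball_of_many_moves hr hε1 (not_le.1 hn) (h.moves q hq)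
        -- A closed block is nonempty: otherwise only vertex `a` is involved, and the ball centered
        -- there contains it.
        have haM : σ.a < σ.M := by
          by_contra hle
          refine hno (p σ.a) fun j h1 h2 _ => ?_
          obtain rfl : σ.a = j := by omega
          simpa using hr.le
        simp only [Scan.advance, if_pos him, if_neg hd, if_neg hn]
        refine ⟨⟨le_rfl, le_rfl, hle_m, hMm, hb, fun he => he, by simp, ?_,
          fun j h1 h2 => absurd h1 h2.not_ge, fun q _ => by simp, fun _ φ Q hφ hQ => ?_,
          Or.inl ⟨hcov.add_block haM hs, fun he => absurd he hMm.ne⟩⟩,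
          fun hlt => absurd hlt (lt_irrefl _)⟩
        -- With `L = M - a ≥ 1`, closing loses at most `(6 / ε)(L + 1) + L`, which the gain `2 (6 /
        -- ε + 1) L + 1` exceeds by at least one.
        · have hn6 : (σ.n : ℝ) ≤ 6 / ε := (le_div_iff₀ hε).2 h.n_le
          have haM' : (σ.a : ℝ) + 1 ≤ σ.M := by exact_mod_cast haM
          have h1 : (σ.n : ℝ) * (σ.M - σ.a + 1) ≤ 6 / ε * (σ.M - σ.a + 1) :=
            mul_le_mul_of_nonneg_right hn6 (by linarith)
          have h2 : 0 ≤ (6 / ε) * ((σ.M : ℝ) - σ.a - 1) :=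
            mul_nonneg (by positivity) (by linarith)
          push_cast
          nlinarith
        · have hab := h.lower him φ Q hφ hQ
          -- Were vertex `M` assigned to an index at most `b`, monotonicity would assign all of `a,
          -- …, M` to `b`, and one ball of radius `r` would contain them.
          by_contra hlt
          simp only at hlt
          refine hno (Q σ.b) fun j h1 h2 h3 => ?_
          have g1 := hφ _ _ h1 h3
          have g2 := hφ _ _ h2 hMm
          have : φ j = σ.b := by omega
          exact this ▸ hQ j h3
  · have hi : σ.i = m := by omega
    have hM : σ.M = m := by omega
    have h0 : σ.a < m := h.a_lt_m
    simp only [Scan.advance, if_neg him]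
    refine ⟨⟨hle_i, hle_M, hle_m, h.a_lt_m, hb, h.i_eq_m, h.n_le, ?_, h.center, h.moves,
      fun hlt => absurd hlt him, Or.inr ⟨hi, ?_⟩⟩, fun hlt => by simp only at hlt; omega⟩
    · push_cast
      linarith
    -- The first such round closes the last block; later rounds repeat its center.
    · rcases h.upper with hu | hu
      · exact hu.1.add_block h0 fun j h1 h2 => hs j h1 (by omega)
      · obtain ⟨m', rfl⟩ : ∃ m', m = m' + 1 := ⟨m - 1, by omega⟩
        exact hu.2.add_repeat (hs m' (by omega) (by omega))

theorem Inv.step [InnerProductSpace ℝ E] (hr : 0 < r) (hε : 0 < ε) (hε1 : ε ≤ 1) (h : Inv m k r ε p t σ)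
    (hb : σ.b < k) : Inv m k r ε p (t + 1) (σ.save.advance m r ε p) := by
  refine h.save.1.advance hr hε hε1 h.save.2 ?_
  unfold Scan.save
  split_ifs <;> exact hb

/-- The initial center is arbitrary: at `n = 0` both sides of `moves` vanish, and the first move has
fraction `1`, so it lands on the violated vertex. -/
theorem inv_init (hm : 1 ≤ m) (hk : 1 ≤ k) (c : E) (out : ℕ → E) :
    Inv m k r ε p 0 ⟨0, 0, 0, 0, 0, c, out⟩ :=
  ⟨⟨le_rfl, le_rfl, Nat.zero_le _, hm, Nat.zero_le _, fun h => h, by simp, by simp,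
    fun _ _ h => absurd h (Nat.not_lt_zero _), fun _ _ => by simp, fun _ _ _ _ _ => Nat.zero_le _,
    Or.inl ⟨Or.inl ⟨rfl, rfl⟩, fun _ => hk⟩⟩, fun h => absurd h (lt_irrefl _)⟩

/-- All indices are at most `m` and `n ≤ 6 / ε`, so the potential is at most `24 m / ε + 4 m`; the
constant 35 leaves slack. -/
theorem Core.rounds_le (hε : 0 < ε) (hε1 : ε ≤ 1) (hkm : k ≤ m) (h : Core m k r ε p t σ) :
    (t : ℝ) ≤ 35 * (m / ε) := by
  have hn6 : (σ.n : ℝ) ≤ 6 / ε := (le_div_iff₀ hε).2 h.n_le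
  have ham : (σ.a : ℝ) ≤ m := Nat.cast_le.2 h.a_lt_m.le
  have hMm : (σ.M : ℝ) ≤ m := Nat.cast_le.2 h.M_le_m
  have hiM : (σ.i : ℝ) ≤ σ.M := Nat.cast_le.2 h.i_le_M
  have hbm : (σ.b : ℝ) ≤ m := Nat.cast_le.2 (h.b_le_k.trans hkm)
  have hm1 : (1 : ℝ) ≤ m := by exact_mod_cast (Nat.zero_le _).trans_lt h.a_lt_m
  have haM : (σ.a : ℝ) ≤ σ.M := Nat.cast_le.2 (h.a_le_i.trans h.i_le_M)
  have ha0 : (0 : ℝ) ≤ σ.a := Nat.cast_nonneg _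
  have h1 : (σ.n : ℝ) * (σ.M - σ.a + 1) ≤ 6 / ε * (2 * m) :=
    mul_le_mul hn6 (by linarith) (by linarith) (by positivity)
  have h2 : 2 * (6 / ε + 1) * (σ.a : ℝ) ≤ 2 * (6 / ε + 1) * m := by gcongr
  have h3 : (m : ℝ) ≤ m / ε := le_div_self (by linarith) hε hε1
  have h4 : 6 / ε * (2 * (m : ℝ)) = 12 * (m / ε) := by ring
  have h5 : 2 * (6 / ε + 1) * (m : ℝ) = 12 * (m / ε) + 2 * m := by ring
  have := h.rounds
  linarith

end Scan

/-! ### The main program and its refinement of the scan -/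

/-- Advance to the next vertex, and move the end of the enclosed part if it is passed. -/
def acceptVertex : RamProg :=
  block [nadd 3 3 13, nadd 4 4 0]
    (branch (nlt 5 3) (block [nadd 5 3 14] (instr (nadd 6 4 14))) (instr (nconst 12 0)))

/-- Move the center towards the violated vertex and restart the block. -/
def retryBlock : RamProg :=
  block [radd 6 3 10, rdiv 7 10 6]
    (seq moveCenter (block [radd 3 3 9, nadd 3 7 14] (instr (nadd 4 8 14))))

/-- Close the current block and start the next one. -/
def closeBlock : RamProg :=
  block [nadd 9 9 13, nadd 10 10 0, nadd 7 5 14, nadd 8 6 14, nadd 3 5 14, nadd 4 6 14]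
    (instr (rconst 3 0))

/-- One round of the scan. The natural-number registers `3, 5, 7, 9` hold the next vertex, the end
of the enclosed part, the start of the block and its number; the registers `4, 6, 8, 10` hold the
same numbers times the dimension. The real register `3` holds the number of moves of the center. -/
def scanRound : RamProg :=
  seq (branch (nle 5 3) saveCenter (instr (nconst 12 0)))
    (branch (nlt 3 1)
      (seq sqDistCenter (branch (rle 4 2) acceptVertex
        (block [radd 5 3 9, rmul 5 5 1] (branch (rle 5 11) retryBlock closeBlock))))
      (block [nadd 9 9 13] (instr (nadd 10 10 0))))

/-- The simplification algorithm. -/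
def simplifyProg : RamProg :=
  block [rconst 9 1, radd 2 1 9, rmul 2 2 0, rmul 2 2 2, nconst 13 1, rconst 10 2, rconst 11 6]
    (seq (loop (nlt 9 2) scanRound) (branch (nlt 3 1) (instr (nconst 0 0)) (instr (nconst 0 1))))

/-- The state `s` of the machine represents the state `σ` of the scan. -/
structure Represents {d : ℕ} (m k : ℕ) (r ε : ℝ) (p : ℕ → EuclideanSpace ℝ (Fin d))
    (σ : Scan (EuclideanSpace ℝ (Fin d))) (s : RamState) : Prop where
  dim : s.nreg 0 = d
  len : s.nreg 1 = m
  num : s.nreg 2 = k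
  i : s.nreg 3 = σ.i
  oi : s.nreg 4 = σ.i * d
  M : s.nreg 5 = σ.M
  oM : s.nreg 6 = σ.M * d
  a : s.nreg 7 = σ.a
  oa : s.nreg 8 = σ.a * d
  b : s.nreg 9 = σ.b
  ob : s.nreg 10 = σ.b * d
  one : s.nreg 13 = 1
  zero : s.nreg 14 = 0
  eps : s.rreg 1 = ε
  thr : s.rreg 2 = ((1 + ε) * r) ^ 2
  cnt : s.rreg 3 = σ.n
  rone : s.rreg 9 = 1
  two : s.rreg 10 = 2
  six : s.rreg 11 = 6
  pts : ∀ i, i < m → s.vec d 0 (i * d) = p i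
  c : s.vec d 2 0 = σ.c
  out : ∀ j, s.vec d 1 (j * d) = σ.out j

section Refinement

variable {d m k : ℕ} {r ε : ℝ} {p : ℕ → EuclideanSpace ℝ (Fin d)}
  {σ : Scan (EuclideanSpace ℝ (Fin d))} {s : RamState}

/-- `Represents` is insensitive to the scratch registers. -/
theorem Represents.of_agree (h : Represents m k r ε p σ s) {s' : RamState}
    (hn : ∀ x, x ≠ 11 → x ≠ 12 → s'.nreg x = s.nreg x)
    (hr : ∀ x, x ≠ 4 → x ≠ 5 → x ≠ 6 → x ≠ 7 → s'.rreg x = s.rreg x)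
    (hp : s'.rarr 0 = s.rarr 0) {c : EuclideanSpace ℝ (Fin d)} (hc : s'.vec d 2 0 = c)
    {out : ℕ → EuclideanSpace ℝ (Fin d)} (hout : ∀ j, s'.vec d 1 (j * d) = out j) :
    Represents m k r ε p { σ with c := c, out := out } s' where
  dim := (hn 0 (by decide) (by decide)).trans h.dim
  len := (hn 1 (by decide) (by decide)).trans h.len
  num := (hn 2 (by decide) (by decide)).trans h.num
  i := (hn 3 (by decide) (by decide)).trans h.i
  oi := (hn 4 (by decide) (by decide)).trans h.oi
  M := (hn 5 (by decide) (by decide)).trans h.M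
  oM := (hn 6 (by decide) (by decide)).trans h.oM
  a := (hn 7 (by decide) (by decide)).trans h.a
  oa := (hn 8 (by decide) (by decide)).trans h.oa
  b := (hn 9 (by decide) (by decide)).trans h.b
  ob := (hn 10 (by decide) (by decide)).trans h.ob
  one := (hn 13 (by decide) (by decide)).trans h.one
  zero := (hn 14 (by decide) (by decide)).trans h.zero
  eps := (hr 1 (by decide) (by decide) (by decide) (by decide)).trans h.eps
  thr := (hr 2 (by decide) (by decide) (by decide) (by decide)).trans h.thr
  cnt := (hr 3 (by decide) (by decide) (by decide) (by decide)).trans h.cnt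
  rone := (hr 9 (by decide) (by decide) (by decide) (by decide)).trans h.rone
  two := (hr 10 (by decide) (by decide) (by decide) (by decide)).trans h.two
  six := (hr 11 (by decide) (by decide) (by decide) (by decide)).trans h.six
  pts i hi := by
    rw [← h.pts i hi]
    simp only [RamState.vec, hp]
  c := hc
  out := hout

theorem Represents.setR_scratch (h : Represents m k r ε p σ s) {x : ℕ} (h4 : 4 ≤ x) (h7 : x ≤ 7)
    (v : ℝ) : Represents m k r ε p σ (s.setR x v) :=
  h.of_agree (s' := s.setR x v) (fun _ _ _ => rfl)
    (fun y _ _ _ _ => Function.update_of_ne (by omega) _ _) rfl h.c h.out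

theorem Represents.runs_retry (h : Represents m k r ε p σ s) (him : σ.i < m) :
    retryBlock.Runs s fun s' t => t ≤ 9 * d + 7 ∧ Represents m k r ε p
      { σ with i := σ.a, n := σ.n + 1, c := σ.c + (2 / (σ.n + 2 : ℝ)) • (p σ.i - σ.c) } s' := by
  -- This makes the division instruction defined.
  have hne : (σ.n : ℝ) + 2 ≠ 0 := by positivity
  simp only [retryBlock, block, List.foldr, runs_seq, runs_instr, RamInstr.eval,
    Option.some.injEq, exists_eq_left']
  refine ⟨(s.setR 6 (σ.n + 2)).setR 7 (2 / (σ.n + 2)), by simp [h.cnt, h.two, hne], ?_⟩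
  have h' := (h.setR_scratch (x := 6) (by norm_num) (by norm_num) (σ.n + 2)).setR_scratch
    (x := 7) (by norm_num) (by norm_num) (2 / (σ.n + 2))
  refine (runs_moveCenter h'.dim h'.one).mono ?_
  rintro s₂ t₂ ⟨ht, hn, hr, ha, hc⟩
  rw [h'.oi, h'.pts _ him, h'.c, RamState.rreg_setR, Function.update_self] at hc
  have h₂ := h'.of_agree hn (fun x _ h5 h6 _ => hr x h5 h6) (ha 0 (by decide)) hc
    (out := σ.out) (fun j => by rw [← h'.out]; simp only [RamState.vec, ha 1 (by decide)])
  refine ⟨by omega, ?_⟩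
  clear hn hr ha h' h
  obtain ⟨⟩ := h₂
  constructor <;> simp [*]
  assumption

theorem Represents.runs_save (h : Represents m k r ε p σ s) :
    (branch (nle 5 3) saveCenter (instr (nconst 12 0))).Runs s fun s' t =>
      t ≤ 5 * d + 3 ∧ Represents m k r ε p σ.save s' := by
  by_cases hM : σ.M ≤ σ.i
  · refine runs_branch_of_holds (by simpa [RamTest.Holds, h.M, h.i] using hM)
      ((runs_saveCenter h.dim h.one).mono ?_)
    rintro s' t ⟨ht, hn, hr, ha, h1⟩
    simp only [Scan.save, if_pos hM]
    refine ⟨by omega, h.of_agree hn (fun x _ h5 _ _ => hr x h5) (ha 0 (by decide)) ?_ fun j => ?_⟩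
    · rw [← h.c]
      simp only [RamState.vec, ha 2 (by decide)]
    · by_cases hj : j = σ.b
      · subst hj
        rw [Function.update_self, ← h.c]
        ext x
        simp [RamState.vec, h1, h.ob]
      · rw [Function.update_of_ne hj, ← h.out]
        ext x
        have hx := x.2
        simp only [RamState.vec, h1, h.ob]
        rw [if_neg]
        rintro ⟨h2, h3⟩
        -- Distinct output vertices occupy disjoint ranges of `d` cells.
        rcases Nat.lt_or_gt_of_ne hj with hlt | hlt
        all_goals
          have := Nat.mul_le_mul_right d (Nat.succ_le_of_lt hlt)
          rw [Nat.succ_mul] at this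
          omega
  · refine runs_branch_of_not_holds (by simpa [RamTest.Holds, h.M, h.i] using hM) ?_
    simp only [runs_instr, RamInstr.eval, Option.some.injEq, exists_eq_left', Scan.save, if_neg hM]
    exact ⟨by omega, h.of_agree (s' := s.setN 12 0) (fun x _ h12 => by simp [h12])
      (fun _ _ _ _ _ => rfl) rfl h.c h.out⟩

theorem Represents.runs_advance (hr : 0 < r) (hε : 0 < ε) (h : Represents m k r ε p σ s) :
    (branch (nlt 3 1)
      (seq sqDistCenter (branch (rle 4 2) acceptVertex
        (block [radd 5 3 9, rmul 5 5 1] (branch (rle 5 11) retryBlock closeBlock))))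
      (block [nadd 9 9 13] (instr (nadd 10 10 0)))).Runs s fun s' t =>
      t ≤ 17 * d + 20 ∧ Represents m k r ε p (σ.advance m r ε p) s' := by
  by_cases him : σ.i < m
  · refine runs_branch_of_holds (by simpa [RamTest.Holds, h.len, h.i] using him) ?_
    rw [runs_seq]
    refine (runs_sqDistCenter h.dim h.one).mono ?_
    rintro s₁ t₁ ⟨ht₁, hn₁, hr₁, ha₁, hdist⟩
    rw [h.oi, h.pts _ him, h.c] at hdist
    have h₁ : Represents m k r ε p σ s₁ := h.of_agree hn₁ (fun x h4 h5 h6 _ => hr₁ x h4 h5 h6)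
      (by rw [ha₁]) (by rw [← h.c]; simp only [RamState.vec, ha₁])
      fun j => by rw [← h.out]; simp only [RamState.vec, ha₁]
    clear h hn₁ hr₁ ha₁
    -- The machine has no square root, so it compares squares of nonnegative numbers.
    have hacc : (rle 4 2).Holds s₁ ↔ dist (p σ.i) σ.c ≤ (1 + ε) * r := by
      simp only [RamTest.Holds, hdist, h₁.thr]
      exact pow_le_pow_iff_left₀ dist_nonneg (by positivity) two_ne_zero
    by_cases hd : dist (p σ.i) σ.c ≤ (1 + ε) * r
    · simp only [Scan.advance, if_pos him, if_pos hd]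
      refine runs_branch_of_holds (hacc.2 hd) ?_
      simp only [acceptVertex, block, List.foldr, runs_seq, runs_instr, RamInstr.eval,
        Option.some.injEq, exists_eq_left']
      by_cases hM : σ.M < σ.i + 1
      · refine runs_branch_of_holds
          (by simpa [RamTest.Holds, h₁.M, h₁.i, h₁.one] using hM) ?_
        simp only [runs_seq, runs_instr, RamInstr.eval, Option.some.injEq, exists_eq_left']
        refine ⟨by omega, ?_⟩
        rw [max_eq_right (by omega)]
        obtain ⟨⟩ := h₁
        constructor <;> simp [ Nat.succ_mul, *]; assumption
      · refine runs_branch_of_not_holds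
          (by simpa [RamTest.Holds, h₁.M, h₁.i, h₁.one] using hM) ?_
        simp only [runs_instr, RamInstr.eval, Option.some.injEq, exists_eq_left']
        refine ⟨by omega, ?_⟩
        rw [max_eq_left (by omega)]
        obtain ⟨⟩ := h₁
        constructor <;> simp [ Nat.succ_mul, *]; assumption
    · refine runs_branch_of_not_holds (fun hh => hd (hacc.1 hh)) ?_
      simp only [block, List.foldr, runs_seq, runs_instr, RamInstr.eval,
        Option.some.injEq, exists_eq_left']
      by_cases hn : (σ.n + 1 : ℝ) * ε ≤ 6
      · simp only [Scan.advance, if_pos him, if_neg hd, if_pos hn]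
        refine runs_branch_of_holds (by simpa [RamTest.Holds, h₁.cnt, h₁.rone,
          h₁.eps, h₁.six] using hn) ?_
        refine (((h₁.setR_scratch (by norm_num) (by norm_num) _).setR_scratch
          (by norm_num) (by norm_num) _).runs_retry him).mono ?_
        exact fun s' t ht => ⟨by omega, ht.2⟩
      · simp only [Scan.advance, if_pos him, if_neg hd, if_neg hn]
        refine runs_branch_of_not_holds (by simpa [RamTest.Holds, h₁.cnt, h₁.rone,
          h₁.eps, h₁.six] using hn) ?_
        simp only [closeBlock, block, List.foldr, runs_seq, runs_instr, RamInstr.eval,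
          Option.some.injEq, exists_eq_left']
        refine ⟨by omega, ?_⟩
        obtain ⟨⟩ := h₁
        constructor <;> simp [ Nat.succ_mul, *]
        assumption
  · refine runs_branch_of_not_holds (by simpa [RamTest.Holds, h.len, h.i] using him) ?_
    simp only [Scan.advance, if_neg him, block, List.foldr, runs_seq, runs_instr, RamInstr.eval,
      Option.some.injEq, exists_eq_left']
    refine ⟨by omega, ?_⟩
    obtain ⟨⟩ := h
    constructor <;> simp [ Nat.succ_mul, *]; assumption

theorem Represents.runs_scanRound (hr : 0 < r) (hε : 0 < ε) (h : Represents m k r ε p σ s) :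
    scanRound.Runs s fun s' t =>
      t ≤ 22 * d + 23 ∧ Represents m k r ε p (σ.save.advance m r ε p) s' := by
  rw [scanRound, runs_seq]
  refine h.runs_save.mono fun s₁ t₁ h₁ => ?_
  refine (h₁.2.runs_advance hr hε).mono fun s₂ t₂ h₂ => ?_
  exact ⟨by omega, h₂.2⟩

end Refinement

/-! ### Input layout, meaning of the final state, and the main theorem -/

theorem simplificationInput_vec {d m : ℕ} (k : ℕ) (r ε : ℝ) (C : Curve d m) (i : Fin m) :
    (simplificationInput k r ε C).vec d 0 (i * d) = C i := by
  ext x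
  have hx := x.2
  have hd : 0 < d := by omega
  have hlt : (i : ℕ) * d + x < m * d := by
    have := Nat.mul_le_mul_right d (Nat.succ_le_of_lt i.2)
    rw [Nat.succ_mul] at this
    omega
  have h1 : Fin.divNat (⟨i * d + x, hlt⟩ : Fin (m * d)) = i := by
    ext
    simp [Fin.divNat, Nat.mul_add_div hd, Nat.mul_comm (i : ℕ) d, Nat.div_eq_of_lt hx]
  have h2 : Fin.modNat (⟨i * d + x, hlt⟩ : Fin (m * d)) = x := by
    ext
    simp [Fin.modNat, Nat.mul_comm (i : ℕ) d, Nat.mod_eq_of_lt hx]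
  simp only [RamState.vec, simplificationInput, hlt, and_self, dite_true, h1, h2]

/-- The scan that has processed all blocks without reaching the last vertex refutes all curves. -/
theorem Scan.Core.lt_discreteFrechet {d m k t : ℕ} {r ε : ℝ} {C : Curve d m}
    {p : ℕ → EuclideanSpace ℝ (Fin d)} {σ : Scan (EuclideanSpace ℝ (Fin d))}
    (h : σ.Core m k r ε p t) (hp : ∀ i : Fin m, p i = C i) (hr : 0 < r) (hk : 1 ≤ k)
    (hb : k ≤ σ.b) (hi : σ.i < m) (Q : Curve d k) : r < discreteFrechet C Q := by
  by_contra hle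
  have hm : 1 ≤ m := by omega
  obtain ⟨φ, hφ, hd⟩ := exists_monotone_of_discreteFrechet_le hm hk hr.le (not_lt.1 hle)
  -- The assignment and the curve are extended by zero; only indices below `m` and `k` matter.
  have hlow := h.lower hi (fun j => if hj : j < m then φ ⟨j, hj⟩ else 0)
    (fun j => if hj : j < k then Q ⟨j, hj⟩ else 0) ?_ ?_
  · simp only [h.a_lt_m, dite_true] at hlow
    have := (φ ⟨σ.a, h.a_lt_m⟩).2
    omega
  · intro i j hij hj
    simp only [hj, hij.trans_lt hj, dite_true]
    exact hφ (Fin.mk_le_mk.2 hij)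
  · intro j hj
    simp only [hj, dite_true, Fin.is_lt]
    rw [show p j = C ⟨j, hj⟩ from hp ⟨j, hj⟩]
    exact hd ⟨j, hj⟩

/-- The scan that has reached the last vertex and filled the output returns a close curve. -/
theorem Scan.Core.discreteFrechet_le {d m k t : ℕ} {r ε : ℝ} {C : Curve d m}
    {p : ℕ → EuclideanSpace ℝ (Fin d)} {σ : Scan (EuclideanSpace ℝ (Fin d))}
    (h : σ.Core m k r ε p t) (hp : ∀ i : Fin m, p i = C i) (hr : 0 < r) (hε : 0 < ε)
    (hb : σ.b = k) (hi : σ.i = m) (Q : Curve d k) (hQ : ∀ j : Fin k, Q j = σ.out j) :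
    discreteFrechet C Q ≤ (1 + ε) * r := by
  have ham := h.a_lt_m
  rcases h.upper with hu | ⟨-, hu⟩
  -- An open block at the end of the input would force `b < k`.
  · exact absurd (hu.2 hi) hb.not_lt
  · rw [hb] at hu
    rcases hu with ⟨h0, -⟩ | ⟨m', k', rfl, rfl, hpath⟩
    · omega
    · refine discreteFrechet_le_of_latticePath (by positivity) (fun i j hi hj hg => ?_) hpath
      rw [hQ, ← hp]
      exact hg

/-- There is one real-RAM program, with one constant `K` and one polynomial `q`, that works for all
inputs. It ends with `1` in the natural-number register `0` when it returns a curve, and with `0`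
when it declares that there is none. -/
theorem lemma4p1 :
    ∃ (prog : RamProg) (K : ℝ) (q : Polynomial ℝ),
      ∀ (d m k : ℕ) (r ε : ℝ) (C : Curve d m),
        1 ≤ d → 1 ≤ k → k ≤ m → 0 < r → 0 < ε → ε ≤ 1 →
        ∃ (s : RamState) (t : ℕ),
          RamExec prog (simplificationInput k r ε C) s t ∧
          (t : ℝ) ≤ K * ((d : ℝ) * m * Real.log (m + 1) / ε) + m * q.eval (1 / ε) ∧
          ((s.nreg 0 = 1 ∧ discreteFrechet C (outputCurve d k s) ≤ (1 + ε) * r) ∨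
           (s.nreg 0 = 0 ∧ ∀ Q : Curve d k, r < discreteFrechet C Q)) := by
  -- The running time is `O(d m / ε)`, so no polynomial term is needed, and the logarithm enters
  -- only through `log (m + 1) ≥ log 2`. The constant is `1620 = 35 · 46 + 10`, with `22 d + 24 ≤ 46
  -- d`.
  refine ⟨simplifyProg, 1620 / Real.log 2, 0, fun d m k r ε C hd hk hkm hr hε hε1 => ?_⟩
  set s₀ := simplificationInput k r ε C
  have hn₀ : ∀ i, s₀.nreg i = if i = 0 then d else if i = 1 then m else if i = 2 then k else 0 :=
    fun _ => rfl
  have hr₀ : ∀ x, s₀.rreg x = if x = 0 then r else if x = 1 then ε else 0 := fun _ => rfl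
  set p : ℕ → EuclideanSpace ℝ (Fin d) := fun i => s₀.vec d 0 (i * d)
  have hp : ∀ i : Fin m, p i = C i := simplificationInput_vec k r ε C
  have hm : 1 ≤ m := hk.trans hkm
  -- The summands are the 7 initial instructions, the loop with its failing last test, and the final
  -- branch.
  have hbound : ∀ t : ℕ, t ≤ 7 + (⌊35 * (m / ε)⌋₊ * (22 * d + 24) + 1) + 2 →
      (t : ℝ) ≤ 1620 / Real.log 2 * ((d : ℝ) * m * Real.log (m + 1) / ε) +
        m * (0 : Polynomial ℝ).eval (1 / ε) := by
    intro t ht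
    have hd1 : (1 : ℝ) ≤ d := by exact_mod_cast hd
    have hm1 : (1 : ℝ) ≤ m := by exact_mod_cast hm
    have hlog2 : 0 < Real.log 2 := Real.log_pos (by norm_num)
    have hmε : 1 ≤ (m : ℝ) / ε := (one_le_div hε).2 (hε1.trans hm1)
    have hfl : (⌊35 * (m / ε)⌋₊ : ℝ) ≤ 35 * (m / ε) := Nat.floor_le (by positivity)
    have h1 : (t : ℝ) ≤ 7 + (⌊35 * (m / ε)⌋₊ * (22 * d + 24) + 1) + 2 := by exact_mod_cast ht
    have h2 : (⌊35 * (m / ε)⌋₊ : ℝ) * (22 * d + 24) ≤ 35 * (m / ε) * (46 * d) :=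
      mul_le_mul hfl (by linarith) (by positivity) (by positivity)
    have h3 : 1 ≤ (m : ℝ) / ε * d := one_le_mul_of_one_le_of_one_le hmε hd1
    have h4 : Real.log 2 ≤ Real.log (m + 1) := Real.log_le_log (by norm_num) (by linarith)
    have h5 : (d : ℝ) * m / ε ≤ (d * m / ε) * (Real.log (m + 1) / Real.log 2) :=
      le_mul_of_one_le_right (by positivity) ((one_le_div hlog2).2 h4)
    have h6 : 1620 / Real.log 2 * ((d : ℝ) * m * Real.log (m + 1) / ε) =
        1620 * ((d * m / ε) * (Real.log (m + 1) / Real.log 2)) := by ring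
    have h7 : (m : ℝ) / ε * d = d * m / ε := by ring
    rw [Polynomial.eval_zero, h6]
    nlinarith
  have hruns : simplifyProg.Runs s₀ fun s t =>
      t ≤ 7 + (⌊35 * (m / ε)⌋₊ * (22 * d + 24) + 1) + 2 ∧
      ((s.nreg 0 = 1 ∧ discreteFrechet C (outputCurve d k s) ≤ (1 + ε) * r) ∨
        (s.nreg 0 = 0 ∧ ∀ Q : Curve d k, r < discreteFrechet C Q)) := by
    simp only [simplifyProg, block, List.foldr, runs_seq, runs_instr, RamInstr.eval,
      Option.some.injEq, exists_eq_left']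
    refine (runs_loop (fun t s => ∃ σ, Scan.Inv m k r ε p t σ ∧ Represents m k r ε p σ s)
      ⌊35 * (m / ε)⌋₊ (22 * d + 23) ?_ ?_ (n := 0)
      ⟨⟨0, 0, 0, 0, 0, s₀.vec d 2 0, fun j => s₀.vec d 1 (j * d)⟩,
        Scan.inv_init hm hk _ _, ?_⟩).mono ?_
    · rintro n s ⟨σ, hσ, -⟩
      exact Nat.le_floor (hσ.rounds_le hε hε1 hkm)
    · rintro n s ⟨σ, hσ, hs⟩ hb
      simp only [RamTest.Holds, hs.b, hs.num] at hb
      exact (hs.runs_scanRound hr hε).mono fun s' t h => ⟨h.1, _, hσ.step hr hε hε1 hb, h.2⟩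
    · constructor <;> simp [p, hn₀, hr₀]
      ring
    · rintro s t ⟨ht, hb, n, σ, hσ, hs⟩
      simp only [RamTest.Holds, hs.b, hs.num, not_lt] at hb
      replace ht : t ≤ ⌊35 * (m / ε)⌋₊ * (22 * d + 24) + 1 := ht
      by_cases hi : σ.i < m
      · refine runs_branch_of_holds (by simpa [RamTest.Holds, hs.i, hs.len] using hi) ?_
        simp only [runs_instr, RamInstr.eval, Option.some.injEq, exists_eq_left']
        exact ⟨by omega, Or.inr ⟨rfl, hσ.lt_discreteFrechet hp hr hk hb hi⟩⟩
      · refine runs_branch_of_not_holds (by simpa [RamTest.Holds, hs.i, hs.len] using hi) ?_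
        simp only [runs_instr, RamInstr.eval, Option.some.injEq, exists_eq_left']
        have him : σ.i = m := le_antisymm (hσ.i_le_M.trans hσ.M_le_m) (not_lt.1 hi)
        exact ⟨by omega, Or.inl ⟨rfl, hσ.discreteFrechet_le hp hr hε (le_antisymm hσ.b_le_k hb)
          him _ fun j => hs.out j⟩⟩
  obtain ⟨s, t, he, ht, h⟩ := hruns
  exact ⟨s, t, he, hbound t ht, h⟩
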